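/- \textbf{Theorem (Representation of orbifold groupoids).} Let $G$ be an orbifold groupoid over $G_0$, i.e. a proper étale Lie groupoid: the arrows $G$ and the objects $G_0$ are smooth manifolds, $G_0$ is Hausdorff and second countable, all structure maps are smooth, the source and target maps $s,t:G\to G_0$ are local diffeomorphisms, $G$ is Hausdorff, and $(s,t):G\to G_0\times G_0$ is a proper map. Then there exist a continuous family $E=(\{E_x\}_{x\in G_0},\Gamma)$ of finite-dimensional Hilbert spaces over $G_0$ and a faithful unitary representation of $G$ on $E$. Here a \emph{continuous family of Hilbert spaces} over a locally compact Hausdorff space $B$ consists of complex Hilbert spaces $E_x$ $(x\in B)$ and a linear subspace $\Gamma\subset\prod_{x\in B}E_x$ such that (1) for all $x\in B$ and $v\in E_x$ there is $\sigma\in\Gamma$ with $\sigma(x)=v$; (2) for all $\sigma_1,\sigma_2\in\Gamma$ the function $x\mapsto\langle \sigma_1(x),\sigma_2(x)\rangle$ is continuous on $B$; (3) if $w\in\prod_{x\in B}E_x$ is such that for all $x\in B$ and $\varepsilon>0$ there are a neighbourhood $U$ of $x$ and $\sigma\in\Gamma$ with $\|\sigma(x')-w(x')\|<\varepsilon$ for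 all $x'\in U$, then $w\in\Gamma$. The total space $\coprod_{x\in B}E_x$, with projection $p$ to $B$, carries the topology generated by the tubular sets $\{v : p(v)\in V,\ \|\sigma(p(v))-v\|<\varepsilon\}$, for $V\subset B$ open, $\sigma\in\Gamma$ and $\varepsilon>0$. A \emph{representation} of $G$ on $E$ is a left action of $G$ on the total space along $p$, continuous as a map $\{(g,v)\in G\times\coprod_x E_x : s(g)=p(v)\}\to\coprod_x E_x$, in which each arrow $g$ from $x$ to $y$ acts as a linear isomorphism $E_x\to E_y$. It is \emph{unitary} if each arrow acts as a unitary map, and \emph{faithful} if for each $x\in G_0$ the isotropy group $G_x$ of arrows from $x$ to $x$ acts faithfully on $E_x$. -/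

import Mathlib

open scoped Manifold ContDiff Topology

universe u v w

/-! ### Groupoids with a space of arrows -/

/-- The set of all arrows of a groupoid `G` with set of objects `G₀`. -/
structure ArrowSpace (G₀ : Type u) [CategoryTheory.Groupoid.{v} G₀] : Type (max u v) where
  /-- the source of the arrow -/
  src : G₀
  /-- the target of the arrow -/
  tgt : G₀
  /-- the arrow itself -/
  hom : src ⟶ tgt

namespace ArrowSpace

variable {G₀ : Type u} [CategoryTheory.Groupoid.{v} G₀]

/-- The unit map `x ↦ 1ₓ`. -/
def unit (x : G₀) : ArrowSpace G₀ := ⟨x, x, CategoryTheory.CategoryStruct.id x⟩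

/-- The inversion `g ↦ g⁻¹`. -/
def inv (g : ArrowSpace G₀) : ArrowSpace G₀ := ⟨g.tgt, g.src, CategoryTheory.Groupoid.inv g.hom⟩

end ArrowSpace

/-- The set of composable pairs `(g, f)` of arrows `f : x ⟶ y`, `g : y ⟶ z`, that is, the fibre
product of the arrow space with itself over the objects (along source and target). -/
structure ComposablePair (G₀ : Type u) [CategoryTheory.Groupoid.{v} G₀] : Type (max u v) where
  /-- source of the first arrow -/
  x : G₀
  /-- common middle object -/
  y : G₀
  /-- target of the second arrow -/
  z : G₀
  /-- the arrow applied second -/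
  g : y ⟶ z
  /-- the arrow applied first -/
  f : x ⟶ y

namespace ComposablePair

variable {G₀ : Type u} [CategoryTheory.Groupoid.{v} G₀]

/-- A composable pair as an element of the product of two copies of the arrow space. -/
def toProd (p : ComposablePair G₀) : ArrowSpace G₀ × ArrowSpace G₀ :=
  (⟨p.y, p.z, p.g⟩, ⟨p.x, p.y, p.f⟩)

/-- The multiplication `(g, f) ↦ g f`. -/
def mul (p : ComposablePair G₀) : ArrowSpace G₀ :=
  ⟨p.x, p.z, CategoryTheory.CategoryStruct.comp p.f p.g⟩

/-- The fibre product carries the subspace topology. -/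
instance [TopologicalSpace (ArrowSpace G₀)] : TopologicalSpace (ComposablePair G₀) :=
  TopologicalSpace.induced toProd inferInstance

end ComposablePair

/-- A topological groupoid over a Hausdorff space of objects: all structure maps are continuous,
source, target and multiplication are open, and the unit map is an embedding. -/
structure IsTopologicalGroupoid (G₀ : Type u) [CategoryTheory.Groupoid.{v} G₀]
    [TopologicalSpace G₀] [TopologicalSpace (ArrowSpace G₀)] : Prop where
  t2_obj : T2Space G₀
  continuous_src : Continuous (ArrowSpace.src : ArrowSpace G₀ → G₀)
  continuous_tgt : Continuous (ArrowSpace.tgt : ArrowSpace G₀ → G₀)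
  continuous_inv : Continuous (ArrowSpace.inv : ArrowSpace G₀ → ArrowSpace G₀)
  continuous_mul : Continuous (ComposablePair.mul : ComposablePair G₀ → ArrowSpace G₀)
  isOpenMap_src : IsOpenMap (ArrowSpace.src : ArrowSpace G₀ → G₀)
  isOpenMap_tgt : IsOpenMap (ArrowSpace.tgt : ArrowSpace G₀ → G₀)
  isOpenMap_mul : IsOpenMap (ComposablePair.mul : ComposablePair G₀ → ArrowSpace G₀)
  isEmbedding_unit : Topology.IsEmbedding (ArrowSpace.unit : G₀ → ArrowSpace G₀)

/-- A Lie groupoid: a topological groupoid whose spaces of objects and of arrows are smooth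
manifolds (of dimensions `n` and `m`), the objects being Hausdorff and second countable, such that
source and target are smooth submersions with Hausdorff fibres and all structure maps are smooth.
Smoothness of the multiplication on the fibre product, which is an embedded submanifold of the
product of two copies of the arrow space, is expressed by local smooth extensions. -/
structure IsLieGroupoid (n m : ℕ) (G₀ : Type u) [CategoryTheory.Groupoid.{v} G₀]
    [TopologicalSpace G₀] [ChartedSpace (EuclideanSpace ℝ (Fin n)) G₀]
    [TopologicalSpace (ArrowSpace G₀)] [ChartedSpace (EuclideanSpace ℝ (Fin m)) (ArrowSpace G₀)] :
    Prop extends IsTopologicalGroupoid G₀ where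
  isManifold_obj : IsManifold (𝓡 n) ∞ G₀
  isManifold_arrow : IsManifold (𝓡 m) ∞ (ArrowSpace G₀)
  secondCountable_obj : SecondCountableTopology G₀
  t2_src_fibre : ∀ x : G₀, T2Space {g : ArrowSpace G₀ // g.src = x}
  t2_tgt_fibre : ∀ x : G₀, T2Space {g : ArrowSpace G₀ // g.tgt = x}
  submersion_src : Manifold.IsSubmersion (𝓡 m) (𝓡 n) ∞ (ArrowSpace.src : ArrowSpace G₀ → G₀)
  submersion_tgt : Manifold.IsSubmersion (𝓡 m) (𝓡 n) ∞ (ArrowSpace.tgt : ArrowSpace G₀ → G₀)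
  smooth_unit : ContMDiff (𝓡 n) (𝓡 m) ∞ (ArrowSpace.unit : G₀ → ArrowSpace G₀)
  smooth_inv : ContMDiff (𝓡 m) (𝓡 m) ∞ (ArrowSpace.inv : ArrowSpace G₀ → ArrowSpace G₀)
  smooth_mul : ∀ p : ComposablePair G₀, ∃ U ∈ 𝓝 p.toProd,
    ∃ F : ArrowSpace G₀ × ArrowSpace G₀ → ArrowSpace G₀,
      ContMDiffOn ((𝓡 m).prod (𝓡 m)) (𝓡 m) ∞ F U ∧
        ∀ q : ComposablePair G₀, q.toProd ∈ U → F q.toProd = q.mul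

/-- An orbifold groupoid: a proper étale Lie groupoid. Proper means that the arrow space is
Hausdorff and `(s, t)` is a proper map; étale means that `s` and `t` are local diffeomorphisms. -/
structure IsOrbifoldGroupoid (n m : ℕ) (G₀ : Type u) [CategoryTheory.Groupoid.{v} G₀]
    [TopologicalSpace G₀] [ChartedSpace (EuclideanSpace ℝ (Fin n)) G₀]
    [TopologicalSpace (ArrowSpace G₀)] [ChartedSpace (EuclideanSpace ℝ (Fin m)) (ArrowSpace G₀)] :
    Prop extends IsLieGroupoid n m G₀ where
  t2_arrow : T2Space (ArrowSpace G₀)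
  proper : IsProperMap fun g : ArrowSpace G₀ => (g.src, g.tgt)
  etale_src : IsLocalDiffeomorph (𝓡 m) (𝓡 n) ∞ (ArrowSpace.src : ArrowSpace G₀ → G₀)
  etale_tgt : IsLocalDiffeomorph (𝓡 m) (𝓡 n) ∞ (ArrowSpace.tgt : ArrowSpace G₀ → G₀)

/-! ### Continuous families of Hilbert spaces -/

/-- A continuous family of (complex) Hilbert spaces over a locally compact Hausdorff space `B`. -/
structure HilbertFamily (B : Type u) [TopologicalSpace B] [LocallyCompactSpace B] [T2Space B] :
    Type (max u (w + 1)) where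
  /-- the Hilbert space over a point -/
  fibre : B → Type w
  [normed : ∀ x, NormedAddCommGroup (fibre x)]
  [innerProduct : ∀ x, InnerProductSpace ℂ (fibre x)]
  [complete : ∀ x, CompleteSpace (fibre x)]
  /-- the space `Γ` of sections -/
  sections : Submodule ℂ (∀ x, fibre x)
  exists_section : ∀ (x : B) (e : fibre x), ∃ s ∈ sections, s x = e
  continuous_inner : ∀ s₁ ∈ sections, ∀ s₂ ∈ sections,
    Continuous fun x => inner ℂ (s₁ x) (s₂ x)
  mem_of_locally_approx : ∀ e : (∀ x, fibre x),
    (∀ (x : B) (ε : ℝ), 0 < ε → ∃ U ∈ 𝓝 x, ∃ s ∈ sections, ∀ y ∈ U, ‖s y - e y‖ < ε) →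
      e ∈ sections

namespace HilbertFamily

attribute [instance] HilbertFamily.normed HilbertFamily.innerProduct HilbertFamily.complete

variable {B : Type u} [TopologicalSpace B] [LocallyCompactSpace B] [T2Space B]

/-- A family of finite dimensional Hilbert spaces. -/
def IsFiniteDimensional (E : HilbertFamily.{u, w} B) : Prop :=
  ∀ x, FiniteDimensional ℂ (E.fibre x)

/-- The total space, the disjoint union of the fibres. -/
structure Total (E : HilbertFamily.{u, w} B) : Type (max u w) where
  /-- the projection to the base -/
  base : B
  /-- the vector in the fibre -/
  vec : E.fibre base

/-- The tubular set of radius `ε` around the section `s` over `V`. -/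
def tube (E : HilbertFamily.{u, w} B) (V : Set B) (s : ∀ x, E.fibre x) (ε : ℝ) : Set E.Total :=
  {e | e.base ∈ V ∧ ‖s e.base - e.vec‖ < ε}

/-- The topology of the total space, generated by the tubular sets around sections in `Γ` over
open sets. -/
instance (E : HilbertFamily.{u, w} B) : TopologicalSpace E.Total :=
  TopologicalSpace.generateFrom
    {W | ∃ V : Set B, IsOpen V ∧ ∃ s ∈ E.sections, ∃ ε : ℝ, 0 < ε ∧ W = E.tube V s ε}

end HilbertFamily

/-! ### Representations of groupoids -/

/-- The fibre product of the arrow space of `G` (along the source) and the total space of a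
family of Hilbert spaces over the space of objects: pairs of an arrow `g` and a vector in the
fibre over the source of `g`. -/
structure ActionDomain {G₀ : Type u} [CategoryTheory.Groupoid.{v} G₀] [TopologicalSpace G₀]
    [LocallyCompactSpace G₀] [T2Space G₀] (E : HilbertFamily.{u, w} G₀) :
    Type (max u v w) where
  /-- the arrow -/
  arrow : ArrowSpace G₀
  /-- a vector in the fibre over the source of the arrow -/
  vec : E.fibre arrow.src

namespace ActionDomain

variable {G₀ : Type u} [CategoryTheory.Groupoid.{v} G₀] [TopologicalSpace G₀]
  [LocallyCompactSpace G₀] [T2Space G₀] {E : HilbertFamily.{u, w} G₀}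

/-- The inclusion of the fibre product into the product. -/
def toProd (p : ActionDomain E) : ArrowSpace G₀ × E.Total := (p.arrow, ⟨p.arrow.src, p.vec⟩)

/-- The fibre product carries the subspace topology. -/
instance [TopologicalSpace (ArrowSpace G₀)] : TopologicalSpace (ActionDomain E) :=
  TopologicalSpace.induced toProd inferInstance

end ActionDomain

/-- A continuous representation of a groupoid on a continuous family `E` of Hilbert spaces over
its space of objects: a continuous left action on the total space of `E` along the projection, in
which each arrow `g : x ⟶ y` acts by a linear isomorphism from the fibre over `x` to the fibre
over `y`. -/
structure GroupoidRep {G₀ : Type u} [CategoryTheory.Groupoid.{v} G₀] [TopologicalSpace G₀]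
    [LocallyCompactSpace G₀] [T2Space G₀] [TopologicalSpace (ArrowSpace G₀)]
    (E : HilbertFamily.{u, w} G₀) : Type (max u v w) where
  /-- the action of an arrow -/
  act : ∀ {x y : G₀}, (x ⟶ y) → (E.fibre x ≃ₗ[ℂ] E.fibre y)
  act_id : ∀ (x : G₀) (e : E.fibre x), act (CategoryTheory.CategoryStruct.id x) e = e
  act_comp : ∀ {x y z : G₀} (f : x ⟶ y) (g : y ⟶ z) (e : E.fibre x),
    act (CategoryTheory.CategoryStruct.comp f g) e = act g (act f e)
  continuous_act : Continuous fun p : ActionDomain E =>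
    (⟨p.arrow.tgt, act p.arrow.hom p.vec⟩ : E.Total)

namespace GroupoidRep

variable {G₀ : Type u} [CategoryTheory.Groupoid.{v} G₀] [TopologicalSpace G₀]
  [LocallyCompactSpace G₀] [T2Space G₀] [TopologicalSpace (ArrowSpace G₀)]
  {E : HilbertFamily.{u, w} G₀}

/-- Each arrow acts as a unitary map between the fibres. -/
def IsUnitary (ρ : GroupoidRep E) : Prop :=
  ∀ {x y : G₀} (g : x ⟶ y) (e e' : E.fibre x), inner ℂ (ρ.act g e) (ρ.act g e') = inner ℂ e e'

/-- For each object `x`, the isotropy group at `x` acts faithfully on the fibre over `x`. -/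
def IsFaithful (ρ : GroupoidRep E) : Prop :=
  ∀ x : G₀, Function.Injective fun g : x ⟶ x => ρ.act g

end GroupoidRep

/-! The representation is a finite-dimensional substitute for the regular one. Arrows into `x` form
a discrete set on which arrows out of `x` act by composition, but this set may be infinite. Hence
only arrows with source in an open set `W` are kept, and `E_x` is the Hermitian space of functions
on them. Composition permutes these arrows, so the action is unitary. It is faithful because `W`
meets every orbit and arrows are cancellable.

Two things must be arranged. Properness gives a Hausdorff, paracompact orbit space, and a locally
finite cover of it yields a `W` for which the relevant arrows are locally confined to a compact set
(`exists_isProperTransversal`). The dimension of `E_x` may still jump, so sections are taken to be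
those whose extension by zero to all arrows is continuous. They die out where a source leaves `W`,
and inner products become fibre sums along the local homeomorphism `tgt`
(`IsLocalHomeomorph.continuous_finsum_fibre`). The action is continuous because sections pull back
along local bisections (`exists_translate`). -/

open CategoryTheory Set Filter

/-! ### The orbit space and a proper transversal -/

section Orbits

variable {G₀ : Type u} [Groupoid.{v} G₀] [TopologicalSpace G₀] [TopologicalSpace (ArrowSpace G₀)]

/-- An open set of objects meeting every orbit, such that locally on the objects the arrows
starting in it start in a compact set. -/
structure IsProperTransversal (W : Set G₀) : Prop where
  isOpen : IsOpen W
  exists_hom (x : G₀) : ∃ a ∈ W, Nonempty (a ⟶ x)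
  exists_isCompact (x : G₀) : ∃ N ∈ 𝓝 x, ∃ L : Set G₀, IsCompact L ∧
    ∀ g : ArrowSpace G₀, g.tgt ∈ N → g.src ∈ W → g.src ∈ L

/-- Isomorphism of objects: the equivalence relation whose classes are the orbits. -/
def orbitSetoid (G₀ : Type u) [Groupoid.{v} G₀] : Setoid G₀ where
  r x y := Nonempty (x ⟶ y)
  iseqv := ⟨fun x => ⟨𝟙 x⟩, fun ⟨f⟩ => ⟨Groupoid.inv f⟩, fun ⟨f⟩ ⟨g⟩ => ⟨f ≫ g⟩⟩

/-- The saturation of an open set `V` is `tgt (src⁻¹ V)`, which is open. -/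
theorem isOpenQuotientMap_orbit
    (hs : Continuous (ArrowSpace.src : ArrowSpace G₀ → G₀))
    (ht : IsOpenMap (ArrowSpace.tgt : ArrowSpace G₀ → G₀)) :
    IsOpenQuotientMap (Quotient.mk (orbitSetoid G₀)) := by
  refine ⟨Quotient.mk_surjective, continuous_quotient_mk', fun V hV => ?_⟩
  rw [← isQuotientMap_quotient_mk'.isOpen_preimage]
  convert ht _ (hV.preimage hs)
  ext y
  constructor
  · rintro ⟨x, hx, hxy⟩
    obtain ⟨f⟩ : Nonempty (x ⟶ y) := Quotient.exact hxy
    exact ⟨⟨x, y, f⟩, hx, rfl⟩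
  · rintro ⟨⟨x, y, f⟩, hx, rfl⟩
    exact ⟨x, hx, Quotient.sound ⟨f⟩⟩

/-- The orbit relation is the range of the proper map `(src, tgt)`, hence closed, so the orbit space
is Hausdorff. It is also locally compact and second countable, and `W` is assembled from relatively
compact lifts of a locally finite cover. -/
theorem exists_isProperTransversal [LocallyCompactSpace G₀] [T2Space G₀]
    [SecondCountableTopology G₀]
    (hs : Continuous (ArrowSpace.src : ArrowSpace G₀ → G₀))
    (ht : IsOpenMap (ArrowSpace.tgt : ArrowSpace G₀ → G₀))
    (hp : IsProperMap fun g : ArrowSpace G₀ => (g.src, g.tgt)) :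
    ∃ W : Set G₀, IsProperTransversal W := by
  have hπ := isOpenQuotientMap_orbit hs ht
  have : T2Space (Quotient (orbitSetoid G₀)) := by
    rw [t2Space_iff_of_isOpenQuotientMap hπ]
    convert hp.isClosedMap.isClosed_range
    ext ⟨x, y⟩
    constructor
    · intro h
      obtain ⟨f⟩ : Nonempty (x ⟶ y) := Quotient.exact h
      exact ⟨⟨x, y, f⟩, rfl⟩
    · rintro ⟨⟨a, b, f⟩, h⟩
      cases h
      exact Quotient.sound ⟨f⟩
  have : LocallyCompactSpace (Quotient (orbitSetoid G₀)) := hπ.locallyCompactSpace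
  have : SecondCountableTopology (Quotient (orbitSetoid G₀)) :=
    hπ.isQuotientMap.secondCountableTopology hπ.isOpenMap
  -- The basis is indexed by open sets of objects, so that the refinement below comes with
  -- relatively compact lifts and not just open sets of orbits.
  have hB : ∀ q : Quotient (orbitSetoid G₀), (𝓝 q).HasBasis
      (fun V : Set G₀ => V ∈ 𝓝 q.out ∧ IsOpen V ∧ IsCompact (closure V))
      (fun V => Quotient.mk (orbitSetoid G₀) '' V) := by
    intro q
    refine ⟨fun T => ⟨fun hT => ?_, ?_⟩⟩
    · obtain ⟨K, hK, hKx⟩ := exists_compact_mem_nhds q.out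
      have hT' : Quotient.mk (orbitSetoid G₀) ⁻¹' T ∈ 𝓝 q.out :=
        hπ.continuous.continuousAt (by rwa [Quotient.out_eq])
      refine ⟨interior (K ∩ Quotient.mk (orbitSetoid G₀) ⁻¹' T),
        ⟨interior_mem_nhds.2 (inter_mem hKx hT'), isOpen_interior, ?_⟩, ?_⟩
      · exact hK.closure_of_subset (interior_subset.trans inter_subset_left)
      · exact image_subset_iff.2 (interior_subset.trans inter_subset_right)
    · rintro ⟨V, ⟨hV, -, -⟩, hVT⟩
      refine mem_of_superset ?_ hVT
      have := hπ.isOpenMap.image_mem_nhds hV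
      rwa [Quotient.out_eq] at this
  obtain ⟨α, c, V, hV, hcov, hfin⟩ := refinement_of_locallyCompact_sigmaCompact_of_nhds_basis hB
  refine ⟨⋃ a, V a, isOpen_iUnion fun a => (hV a).2.1, fun x => ?_, fun x => ?_⟩
  · obtain ⟨a, y, hy, hyx⟩ := mem_iUnion.1 (hcov.symm ▸ mem_univ (Quotient.mk (orbitSetoid G₀) x))
    exact ⟨y, mem_iUnion.2 ⟨a, hy⟩, Quotient.exact hyx⟩
  · obtain ⟨N, hN, hNf⟩ := hfin (Quotient.mk (orbitSetoid G₀) x)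
    refine ⟨_, hπ.continuous.continuousAt hN, _,
      hNf.isCompact_biUnion fun a _ => (hV a).2.2, fun g hgN hgW => ?_⟩
    obtain ⟨a, ha⟩ := mem_iUnion.1 hgW
    have hg : Quotient.mk (orbitSetoid G₀) g.src = Quotient.mk (orbitSetoid G₀) g.tgt :=
      Quotient.sound ⟨g.hom⟩
    -- Source and target lie in one orbit, so the image of `V a` meets `N`: only finitely many `a`
    -- occur.
    exact mem_biUnion (show _ ∈ _ from ⟨_, ⟨g.src, ha, rfl⟩, hg ▸ hgN⟩) (subset_closure ha)

end Orbits

/-! ### Sums over the fibres of a local homeomorphism -/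

section FibreSums

variable {X Y M : Type*} [TopologicalSpace X] [TopologicalSpace Y] [T2Space Y]

/-- Finitely many sets on which `t` is injective cover the compact part of the fibre. -/
theorem IsLocalHomeomorph.finite_compact_inter_fibre {t : X → Y} (ht : IsLocalHomeomorph t)
    {K : Set X} (hK : IsCompact K) (y : Y) : (K ∩ t ⁻¹' {y}).Finite := by
  choose e he hte using ht
  have hc : IsCompact (K ∩ t ⁻¹' {y}) :=
    hK.inter_right (isClosed_singleton.preimage
      (IsLocalHomeomorph.continuous (f := t) fun x => ⟨e x, he x, hte x⟩))
  obtain ⟨F, hF, hcov⟩ := hc.elim_nhds_subcover (fun x => (e x).source)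
    fun x _ => (e x).open_source.mem_nhds (he x)
  refine F.finite_toSet.subset fun x hx => ?_
  obtain ⟨x', hx', hxx'⟩ := mem_iUnion₂.1 (hcov hx)
  have : x = x' := (e x').injOn hxx' (he x') (by
    rw [← hte x']; exact hx.2.trans (hF x' hx').2.symm)
  rwa [this]

/-- The sum over the fibres of a local homeomorphism of a continuous function is continuous, if
the map is locally proper on the support of the function. -/
theorem IsLocalHomeomorph.continuous_finsum_fibre [T2Space X] [AddCommMonoid M]
    [TopologicalSpace M] [ContinuousAdd M] {t : X → Y} (ht : IsLocalHomeomorph t)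
    {F : X → M} (hF : Continuous F)
    (hK : ∀ y, ∃ N ∈ 𝓝 y, ∃ K : Set X, IsCompact K ∧ ∀ x, t x ∈ N → F x ≠ 0 → x ∈ K) :
    Continuous fun y => ∑ᶠ x ∈ t ⁻¹' {y}, F x := by
  refine continuous_iff_continuousAt.2 fun y₀ => ?_
  obtain ⟨N, hN, K, hKc, hKF⟩ := hK y₀
  have hfin := ht.finite_compact_inter_fibre hKc y₀
  have htc := ht.continuous
  choose e he hte using ht
  -- Disjoint neighbourhoods keep the local branches of the inverse of `t` distinct near `y₀`.
  obtain ⟨U, hU, hdisj⟩ := hfin.t2_separation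
  set T := hfin.toFinset
  have hT : ∀ {x}, x ∈ T ↔ x ∈ K ∧ t x = y₀ := by simp [T]
  have hsymm : ∀ x ∈ T, ContinuousAt (e x).symm y₀ ∧ (e x).symm y₀ = x := by
    intro x hx
    have hxy : y₀ = e x x := by rw [← hte x]; exact (hT.1 hx).2.symm
    rw [hxy]
    exact ⟨(e x).continuousAt_symm ((e x).map_source (he x)), (e x).left_inv (he x)⟩
  have h₁ : ∀ᶠ y in 𝓝 y₀, ∀ x ∈ T, y ∈ (e x).target ∧ (e x).symm y ∈ U x := by
    refine (eventually_all_finset T).2 fun x hx => ?_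
    have hxy : y₀ = e x x := by rw [← hte x]; exact (hT.1 hx).2.symm
    refine Eventually.and ?_ ((hsymm x hx).1.eventually ?_)
    · rw [hxy]
      exact (e x).open_target.mem_nhds ((e x).map_source (he x))
    · rw [(hsymm x hx).2]
      exact (hU x).2.mem_nhds (hU x).1
  -- The part of `K` off these branches has compact image missing `y₀`, so nearby fibres have no
  -- further points in `K`.
  have h₂ : ∀ᶠ y in 𝓝 y₀, y ∉ t '' (K \ ⋃ x ∈ T, (e x).source ∩ U x) := by
    refine IsClosed.compl_mem_nhds (((hKc.diff ?_).image htc).isClosed) ?_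
    · exact isOpen_biUnion fun x _ => (e x).open_source.inter (hU x).2
    · rintro ⟨x, ⟨hxK, hx⟩, hxy⟩
      exact hx (mem_biUnion (hT.2 ⟨hxK, hxy⟩) ⟨he x, (hU x).1⟩)
  have h₃ : (fun y => ∑ᶠ x ∈ t ⁻¹' {y}, F x) =ᶠ[𝓝 y₀] fun y => ∑ x ∈ T, F ((e x).symm y) := by
    filter_upwards [h₁, h₂, hN] with y hy₁ hy₂ hyN
    classical
    have hinj : InjOn (fun x => (e x).symm y) (T : Set X) := by
      intro x hx x' hx' hxx'
      by_contra hne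
      refine disjoint_left.1 (hdisj (by simpa [T] using hx) (by simpa [T] using hx') hne)
        (hy₁ x hx).2 ?_
      exact (show (e x).symm y = (e x').symm y from hxx') ▸ (hy₁ x' hx').2
    rw [← Finset.sum_image (f := F) hinj]
    refine finsum_mem_eq_sum_of_inter_support_eq F ?_
    ext z
    simp only [mem_inter_iff, mem_preimage, mem_singleton_iff, Function.mem_support,
      Finset.coe_image, mem_image, Finset.mem_coe, and_congr_left_iff]
    intro hz
    constructor
    · rintro rfl
      have hzK := hKF z hyN hz
      by_contra hcon
      refine hy₂ ⟨z, ⟨hzK, fun hzU => hcon ?_⟩, rfl⟩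
      obtain ⟨x, hx, hzx⟩ := mem_iUnion₂.1 hzU
      refine ⟨x, hx, ?_⟩
      rw [congrFun (hte x) z]
      exact (e x).left_inv hzx.1
    · rintro ⟨x, hx, rfl⟩
      rw [hte x]
      exact (e x).right_inv (hy₁ x hx).1
  refine ContinuousAt.congr ?_ h₃.symm
  refine tendsto_finsetSum T fun x hx => ?_
  exact (hF.continuousAt.tendsto.comp (hsymm x hx).1)

end FibreSums

/-! ### Functions on the arrows from `W`, and their continuous sections -/

/-- The arrows into `x` whose source lies in `W`. -/
structure ArrowInto {G₀ : Type u} [Groupoid.{v} G₀] (W : Set G₀) (x : G₀) : Type (max u v) where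
  /-- the source of the arrow -/
  src : G₀
  mem : src ∈ W
  /-- the arrow itself -/
  hom : src ⟶ x

namespace ArrowInto

variable {G₀ : Type u} [Groupoid.{v} G₀] {W : Set G₀}

/-- The underlying element of the arrow space. -/
def toArrow {x : G₀} (i : ArrowInto W x) : ArrowSpace G₀ := ⟨i.src, x, i.hom⟩

theorem toArrow_injective (x : G₀) :
    Function.Injective (toArrow : ArrowInto W x → ArrowSpace G₀) := by
  rintro ⟨a, ha, f⟩ ⟨b, hb, g⟩ h
  cases h
  rfl

/-- Composition with an arrow `x ⟶ y` as a bijection from the arrows into `x` to those into `y`. -/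
def postcomp {x y : G₀} (g : x ⟶ y) : ArrowInto W x ≃ ArrowInto W y where
  toFun i := ⟨i.src, i.mem, i.hom ≫ g⟩
  invFun i := ⟨i.src, i.mem, i.hom ≫ Groupoid.inv g⟩
  left_inv i := by simp
  right_inv i := by simp

noncomputable instance (x : G₀) [Finite (ArrowInto W x)] : Fintype (ArrowInto W x) :=
  Fintype.ofFinite _

/-- The extension by zero to the arrow space of a section of the spaces of functions on the
arrows with source in `W`. -/
noncomputable def extend (s : ∀ x : G₀, EuclideanSpace ℂ (ArrowInto W x)) (g : ArrowSpace G₀) : ℂ :=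
  open Classical in if h : g.src ∈ W then s g.tgt ⟨g.src, h, g.hom⟩ else 0

theorem extend_toArrow (s : ∀ x : G₀, EuclideanSpace ℂ (ArrowInto W x)) {x : G₀}
    (i : ArrowInto W x) : extend s i.toArrow = s x i :=
  dif_pos i.mem

theorem extend_of_mem (s : ∀ x : G₀, EuclideanSpace ℂ (ArrowInto W x)) {g : ArrowSpace G₀}
    (h : g.src ∈ W) : extend s g = s g.tgt ⟨g.src, h, g.hom⟩ :=
  dif_pos h

theorem extend_of_notMem (s : ∀ x : G₀, EuclideanSpace ℂ (ArrowInto W x)) {g : ArrowSpace G₀}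
    (h : g.src ∉ W) : extend s g = 0 :=
  dif_neg h

theorem extend_add (s s' : ∀ x : G₀, EuclideanSpace ℂ (ArrowInto W x)) :
    extend (s + s') = extend s + extend s' := by
  ext g
  by_cases h : g.src ∈ W <;> simp [extend, h]

theorem extend_smul (c : ℂ) (s : ∀ x : G₀, EuclideanSpace ℂ (ArrowInto W x)) :
    extend (c • s) = c • extend s := by
  ext g
  by_cases h : g.src ∈ W <;> simp [extend, h]

theorem extend_zero : extend (0 : ∀ x : G₀, EuclideanSpace ℂ (ArrowInto W x)) = 0 := by
  ext g
  by_cases h : g.src ∈ W <;> simp [extend, h]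

/-- A sum over the arrows into `x` from `W` is a sum over the fibre of the target map. -/
theorem sum_eq_finsum {x : G₀} [Finite (ArrowInto W x)] (F : ArrowSpace G₀ → ℂ)
    (hF : ∀ g : ArrowSpace G₀, g.src ∉ W → F g = 0) :
    ∑ i : ArrowInto W x, F i.toArrow = ∑ᶠ g ∈ ArrowSpace.tgt ⁻¹' {x}, F g := by
  classical
  rw [← Finset.sum_image (f := F) (g := toArrow) (toArrow_injective x).injOn]
  refine (finsum_mem_eq_sum_of_inter_support_eq F ?_).symm
  ext g
  simp only [mem_inter_iff, mem_preimage, mem_singleton_iff, Function.mem_support,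
    Finset.coe_image, mem_image, and_congr_left_iff]
  intro hg
  constructor
  · rintro rfl
    exact ⟨⟨g.src, by_contra fun h => hg (hF g h), g.hom⟩, by simp, rfl⟩
  · rintro ⟨i, -, rfl⟩
    rfl

variable [TopologicalSpace G₀] [TopologicalSpace (ArrowSpace G₀)]

/-- Urysohn functions vanishing off `src⁻¹ W` and separating the finitely many arrows into `x`
interpolate any prescribed values. -/
theorem exists_extend_continuous [LocallyCompactSpace (ArrowSpace G₀)] [T2Space (ArrowSpace G₀)]
    [∀ x, Finite (ArrowInto W x)] (hW : IsOpen W)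
    (hs : Continuous (ArrowSpace.src : ArrowSpace G₀ → G₀)) (x : G₀)
    (e : EuclideanSpace ℂ (ArrowInto W x)) :
    ∃ s : ∀ x : G₀, EuclideanSpace ℂ (ArrowInto W x), Continuous (extend s) ∧ s x = e := by
  classical
  have hbump : ∀ i : ArrowInto W x, ∃ f : C(ArrowSpace G₀, ℝ),
      (∀ g, g.src ∉ W → f g = 0) ∧ ∀ j : ArrowInto W x, f j.toArrow = if i = j then 1 else 0 := by
    intro i
    obtain ⟨f, hf₀, hf₁, -⟩ := exists_continuous_zero_one_of_isCompact' (s := {i.toArrow})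
      (t := ArrowSpace.src ⁻¹' Wᶜ ∪ toArrow '' {j : ArrowInto W x | j ≠ i}) isCompact_singleton
      ((hW.isClosed_compl.preimage hs).union (((toFinite _).image _).isClosed)) (by
        rw [disjoint_singleton_left]
        rintro (h | ⟨j, hj, hji⟩)
        · exact h i.mem
        · exact hj (toArrow_injective x hji))
    refine ⟨f, fun g hg => hf₀ (Or.inl hg), fun j => ?_⟩
    split_ifs with h
    · exact hf₁ (by simp [h])
    · exact hf₀ (Or.inr ⟨j, fun h' => h h'.symm, rfl⟩)
  choose f hf₀ hf using hbump
  let s (y : G₀) : EuclideanSpace ℂ (ArrowInto W y) :=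
    WithLp.toLp 2 fun i => ∑ j, e j * (f j i.toArrow : ℂ)
  have key : extend s = fun g => ∑ j, e j * (f j g : ℂ) := by
    ext g
    by_cases h : g.src ∈ W
    · rw [extend_of_mem _ h]
      rfl
    · rw [extend_of_notMem _ h]
      simp [hf₀ _ g h]
  refine ⟨s, key ▸ by fun_prop, ?_⟩
  ext i
  simp [s, hf, apply_ite Complex.ofReal]

theorem continuous_inner_of_extend [T2Space G₀] [T2Space (ArrowSpace G₀)]
    [∀ x, Finite (ArrowInto W x)]
    (ht : IsLocalHomeomorph (ArrowSpace.tgt : ArrowSpace G₀ → G₀))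
    (hK : ∀ y : G₀, ∃ N ∈ 𝓝 y, ∃ K : Set (ArrowSpace G₀), IsCompact K ∧
      ∀ g, g.tgt ∈ N → g.src ∈ W → g ∈ K)
    {s s' : ∀ x : G₀, EuclideanSpace ℂ (ArrowInto W x)} (h : Continuous (extend s))
    (h' : Continuous (extend s')) : Continuous fun x => inner ℂ (s x) (s' x) := by
  have h₀ : ∀ g : ArrowSpace G₀, g.src ∉ W → inner ℂ (extend s g) (extend s' g) = 0 := by
    intro g hg
    rw [extend_of_notMem _ hg, inner_zero_left]
  convert ht.continuous_finsum_fibre (F := fun g => inner ℂ (extend s g) (extend s' g))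
    (by fun_prop) fun y => ?_ using 2 with x
  · rw [← sum_eq_finsum _ h₀, PiLp.inner_apply]
    simp only [extend_toArrow]
  · obtain ⟨N, hN, K, hKc, hNK⟩ := hK y
    exact ⟨N, hN, K, hKc, fun g hg hg' => hNK g hg (by_contra fun hc => hg' (h₀ g hc))⟩

end ArrowInto

/-! ### Compactness and finiteness from properness -/

theorem IsProperTransversal.exists_isCompact_arrow {G₀ : Type u} [Groupoid.{v} G₀]
    [TopologicalSpace G₀] [LocallyCompactSpace G₀] [TopologicalSpace (ArrowSpace G₀)] {W : Set G₀}
    (hW : IsProperTransversal W) (hp : IsProperMap fun g : ArrowSpace G₀ => (g.src, g.tgt))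
    (x : G₀) : ∃ N ∈ 𝓝 x, ∃ K : Set (ArrowSpace G₀), IsCompact K ∧
      ∀ g, g.tgt ∈ N → g.src ∈ W → g ∈ K := by
  obtain ⟨N, hN, L, hL, hNL⟩ := hW.exists_isCompact x
  obtain ⟨C, hC, hCN, hCc⟩ := local_compact_nhds hN
  exact ⟨C, hC, _, hp.isCompact_preimage (hL.prod hCc), fun g hg hg' => ⟨hNL g (hCN hg) hg', hg⟩⟩

theorem IsProperTransversal.finite_arrowInto {G₀ : Type u} [Groupoid.{v} G₀]
    [TopologicalSpace G₀] [LocallyCompactSpace G₀] [T2Space G₀] [TopologicalSpace (ArrowSpace G₀)]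
    {W : Set G₀}
    (hW : IsProperTransversal W) (hp : IsProperMap fun g : ArrowSpace G₀ => (g.src, g.tgt))
    (ht : IsLocalHomeomorph (ArrowSpace.tgt : ArrowSpace G₀ → G₀)) (x : G₀) :
    Finite (ArrowInto W x) := by
  obtain ⟨N, hN, K, hK, hNK⟩ := hW.exists_isCompact_arrow hp x
  have := (ht.finite_compact_inter_fibre hK x).to_subtype
  exact Finite.of_injective
    (fun i : ArrowInto W x => (⟨i.toArrow, hNK _ (mem_of_mem_nhds hN) i.mem, rfl⟩ :
      ↥(K ∩ ArrowSpace.tgt ⁻¹' {x})))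
    fun i j h => ArrowInto.toArrow_injective x (congrArg Subtype.val h)

theorem HilbertFamily.isOpen_tube {B : Type u} [TopologicalSpace B] [LocallyCompactSpace B]
    [T2Space B] (E : HilbertFamily.{u, w} B) {V : Set B} (hV : IsOpen V) {s : ∀ x, E.fibre x}
    (hs : s ∈ E.sections) {ε : ℝ} (hε : 0 < ε) : IsOpen (E.tube V s ε) :=
  TopologicalSpace.isOpen_generateFrom_of_mem ⟨V, hV, s, hs, ε, hε, rfl⟩

/-! ### Local bisections -/

section Translation

variable {G₀ : Type u} [Groupoid.{v} G₀] [TopologicalSpace G₀] [TopologicalSpace (ArrowSpace G₀)]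

/-- Near an arrow, an étale groupoid has a continuous family of arrows, one out of each object. -/
theorem exists_local_bisection (hs : IsLocalHomeomorph (ArrowSpace.src : ArrowSpace G₀ → G₀))
    (g₀ : ArrowSpace G₀) :
    ∃ (O : Set (ArrowSpace G₀)) (D : Set G₀) (Y : G₀ → G₀) (H : ∀ x, x ⟶ Y x),
      IsOpen O ∧ IsOpen D ∧ g₀ ∈ O ∧ (∀ g ∈ O, g.src ∈ D) ∧
      ContinuousOn (fun x => (⟨x, Y x, H x⟩ : ArrowSpace G₀)) D ∧
      ∀ g ∈ O, g = ⟨g.src, Y g.src, H g.src⟩ := by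
  classical
  obtain ⟨e, he, hse⟩ := hs g₀
  have hY : ∀ x, ∃ (y : G₀) (f : x ⟶ y), x ∈ e.target → (⟨x, y, f⟩ : ArrowSpace G₀) = e.symm x := by
    intro x
    by_cases hx : x ∈ e.target
    · have hxs : (e.symm x).src = x := by rw [hse]; exact e.right_inv hx
      generalize e.symm x = k at hxs
      subst hxs
      exact ⟨k.tgt, k.hom, fun _ => rfl⟩
    · exact ⟨x, 𝟙 x, fun h => absurd h hx⟩
  choose Y H hYH using hY
  have hmem : ∀ g ∈ e.source, g.src ∈ e.target := fun g hg => by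
    rw [hse]; exact e.map_source hg
  refine ⟨e.source, e.target, Y, H, e.open_source, e.open_target, he, hmem,
    e.continuousOn_symm.congr fun x hx => hYH x hx, fun g hg => ?_⟩
  rw [hYH _ (hmem g hg), hse]
  exact (e.left_inv hg).symm

end Translation

/-! ### The translation action -/

namespace ArrowInto

variable {G₀ : Type u} [Groupoid.{v} G₀]

theorem postcomp_id_apply {W : Set G₀} [∀ x, Finite (ArrowInto W x)] {x : G₀}
    (e : EuclideanSpace ℂ (ArrowInto W x)) :
    LinearIsometryEquiv.piLpCongrLeft 2 ℂ ℂ (postcomp (𝟙 x)) e = e := by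
  refine PiLp.ext fun i => congrArg (fun j => e j) ?_
  exact (postcomp (𝟙 x)).symm_apply_eq.2 (by simp [postcomp])

theorem postcomp_comp_apply {W : Set G₀} [∀ x, Finite (ArrowInto W x)] {x y z : G₀}
    (f : x ⟶ y) (g : y ⟶ z) (e : EuclideanSpace ℂ (ArrowInto W x)) :
    LinearIsometryEquiv.piLpCongrLeft 2 ℂ ℂ (postcomp (f ≫ g)) e =
      LinearIsometryEquiv.piLpCongrLeft 2 ℂ ℂ (postcomp g)
        (LinearIsometryEquiv.piLpCongrLeft 2 ℂ ℂ (postcomp f) e) := by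
  refine PiLp.ext fun i => congrArg (fun j => e j) ?_
  exact (postcomp (f ≫ g)).symm_apply_eq.2 (by simp [postcomp])

/-- Translation is isometric and carries `e'` to `e`; this matches tubes around a section with tubes
around its pullback. -/
theorem norm_sub_postcomp {W : Set G₀} [∀ x, Finite (ArrowInto W x)] {x y : G₀} {g : x ⟶ y} {e : EuclideanSpace ℂ (ArrowInto W y)}
    {e' : EuclideanSpace ℂ (ArrowInto W x)} (h : ∀ i, e' i = e (postcomp g i))
    (v : EuclideanSpace ℂ (ArrowInto W x)) :
    ‖e - LinearIsometryEquiv.piLpCongrLeft 2 ℂ ℂ (postcomp g) v‖ = ‖e' - v‖ := by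
  have : e = LinearIsometryEquiv.piLpCongrLeft 2 ℂ ℂ (postcomp g) e' := by
    refine PiLp.ext fun i => ?_
    exact (((h ((postcomp g).symm i)).trans
      (congrArg (fun j => e j) ((postcomp g).apply_symm_apply i)))).symm
  rw [this, ← map_sub, LinearIsometryEquiv.norm_map]

variable {W : Set G₀} [TopologicalSpace G₀]
  [LocallyCompactSpace G₀] [T2Space G₀] [TopologicalSpace (ArrowSpace G₀)]

/-- Near an arrow, a section can be pulled back along the nearby arrows. -/
theorem exists_translate (hs : IsLocalHomeomorph (ArrowSpace.src : ArrowSpace G₀ → G₀))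
    (ht : Continuous (ArrowSpace.tgt : ArrowSpace G₀ → G₀))
    (hmul : Continuous (ComposablePair.mul : ComposablePair G₀ → ArrowSpace G₀))
    {s : ∀ x : G₀, EuclideanSpace ℂ (ArrowInto W x)} (h : Continuous (extend s))
    (g₀ : ArrowSpace G₀) :
    ∃ s' : ∀ x : G₀, EuclideanSpace ℂ (ArrowInto W x), Continuous (extend s') ∧
      ∀ᶠ g in 𝓝 g₀, ∀ i : ArrowInto W g.src, s' g.src i = s g.tgt (postcomp g.hom i) := by
  obtain ⟨O, D, Y, H, hO, hD, hg₀, hOD, hcont, hOH⟩ := exists_local_bisection hs g₀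
  -- The bisection exists only over `D`. A cutoff equal to 1 on `C'` and 0 off the interior of `C`
  -- makes the pullback global without changing it near the source of `g₀`.
  obtain ⟨C, hC, hCD, hCc⟩ := local_compact_nhds (hD.mem_nhds (hOD g₀ hg₀))
  obtain ⟨C', hC', hCC', hCc'⟩ := local_compact_nhds (interior_mem_nhds.2 hC)
  obtain ⟨f, hf₀, hf₁, -⟩ := exists_continuous_zero_one_of_isCompact'
    hCc' isOpen_interior.isClosed_compl (disjoint_compl_right_iff_subset.2 hCC')
  let s' (x : G₀) : EuclideanSpace ℂ (ArrowInto W x) :=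
    WithLp.toLp 2 fun i => (f x : ℂ) * s (Y x) (postcomp (H x) i)
  let q (g : ArrowSpace G₀) : ComposablePair G₀ := ⟨g.src, g.tgt, Y g.tgt, H g.tgt, g.hom⟩
  have key : extend s' = fun g => (f g.tgt : ℂ) * extend s (q g).mul := by
    ext g
    by_cases hg : g.src ∈ W
    · rw [extend_of_mem _ hg, extend_of_mem _ (show (q g).mul.src ∈ W from hg)]
      rfl
    · rw [extend_of_notMem _ hg, extend_of_notMem _ (show (q g).mul.src ∉ W from hg), mul_zero]
  have hq : ContinuousOn q (ArrowSpace.tgt ⁻¹' D) := by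
    refine continuousOn_iff_continuous_domRestrict.2 (continuous_induced_rng.2 ?_)
    exact continuousOn_iff_continuous_domRestrict.1 <|
      (hcont.comp ht.continuousOn fun g hg => hg).prodMk
        (continuousOn_id (s := ArrowSpace.tgt ⁻¹' D))
  refine ⟨s', key ▸ continuous_iff_continuousAt.2 fun g => ?_, ?_⟩
  · by_cases hg : g.tgt ∈ D
    · refine ContinuousAt.mul (by fun_prop) ?_
      exact (h.comp hmul).continuousAt.comp (hq.continuousAt ((hD.preimage ht).mem_nhds hg))
    · refine (continuousAt_const (y := (0 : ℂ))).congr ?_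
      filter_upwards [ht.continuousAt (hCc.isClosed.isOpen_compl.mem_nhds fun hgC => hg (hCD hgC))]
        with k hk
      rw [hf₀ fun hkC => hk (interior_subset hkC)]
      simp
  · filter_upwards [hO.mem_nhds hg₀, hs.continuous.continuousAt hC'] with g hg hgC i
    have hfg : f g.src = 1 := hf₁ hgC
    have hgH := hOH g hg
    obtain ⟨x, y, k⟩ := g
    dsimp only at hgH hfg i ⊢
    obtain rfl : y = Y x := congrArg ArrowSpace.tgt hgH
    obtain rfl : k = H x := by injection hgH
    simp [s', hfg]

variable (W) [LocallyCompactSpace (ArrowSpace G₀)] [T2Space (ArrowSpace G₀)]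
  [∀ x, Finite (ArrowInto W x)]

/-- The family of the spaces of functions on the arrows into `x` with source in `W`. -/
noncomputable def hilbertFamily (hW : IsOpen W)
    (hs : Continuous (ArrowSpace.src : ArrowSpace G₀ → G₀))
    (ht : IsLocalHomeomorph (ArrowSpace.tgt : ArrowSpace G₀ → G₀))
    (hK : ∀ y : G₀, ∃ N ∈ 𝓝 y, ∃ K : Set (ArrowSpace G₀), IsCompact K ∧
      ∀ g, g.tgt ∈ N → g.src ∈ W → g ∈ K) : HilbertFamily.{u, max u v} G₀ where
  fibre x := EuclideanSpace ℂ (ArrowInto W x)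
  sections :=
    { carrier := {s | Continuous (extend s)}
      add_mem' := fun {s s'} h h' => by
        rw [mem_ofPred_eq, extend_add]
        exact Continuous.add h h'
      zero_mem' := by
        rw [mem_ofPred_eq, extend_zero]
        exact continuous_zero
      smul_mem' := fun c s h => by
        rw [mem_ofPred_eq, extend_smul]
        exact Continuous.const_smul h c }
  exists_section x e := exists_extend_continuous hW hs x e
  continuous_inner _ h _ h' := continuous_inner_of_extend ht hK h h'
  mem_of_locally_approx e he := by
    -- Coordinates are bounded by the norm and both extensions vanish off `src⁻¹ W`, so closeness
    -- over `U` is uniform closeness on `tgt⁻¹ U`.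
    refine continuous_of_locally_uniform_approx_of_continuousAt fun g u hu => ?_
    obtain ⟨ε, hε, hεu⟩ := Metric.mem_uniformity_dist.1 hu
    obtain ⟨U, hU, s, hs', hUs⟩ := he g.tgt ε hε
    refine ⟨_, ht.continuous.continuousAt hU, extend s, Continuous.continuousAt hs',
      fun k hk => hεu ?_⟩
    by_cases hkW : k.src ∈ W
    · rw [extend_of_mem _ hkW, extend_of_mem _ hkW, dist_comm, dist_eq_norm]
      exact (PiLp.norm_apply_le (s k.tgt - e k.tgt) ⟨k.src, hkW, k.hom⟩).trans_lt (hUs _ hk)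
    · rwa [extend_of_notMem _ hkW, extend_of_notMem _ hkW, dist_self]

variable {W}

/-- The action of the arrows on functions by translation. -/
noncomputable def translationRep (hW : IsOpen W)
    (hs : IsLocalHomeomorph (ArrowSpace.src : ArrowSpace G₀ → G₀))
    (ht : IsLocalHomeomorph (ArrowSpace.tgt : ArrowSpace G₀ → G₀))
    (hmul : Continuous (ComposablePair.mul : ComposablePair G₀ → ArrowSpace G₀))
    (hK : ∀ y : G₀, ∃ N ∈ 𝓝 y, ∃ K : Set (ArrowSpace G₀), IsCompact K ∧
      ∀ g, g.tgt ∈ N → g.src ∈ W → g ∈ K) :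
    GroupoidRep (hilbertFamily W hW hs.continuous ht hK) where
  act g := (LinearIsometryEquiv.piLpCongrLeft 2 ℂ ℂ (postcomp g)).toLinearEquiv
  act_id x e := postcomp_id_apply e
  act_comp f g e := postcomp_comp_apply f g e
  continuous_act := by
    refine continuous_generateFrom_iff.2 ?_
    rintro _ ⟨V, hV, s, hsec, ε, hε, rfl⟩
    refine isOpen_iff_mem_nhds.2 fun p₀ hp₀ => ?_
    obtain ⟨s', hs', hss'⟩ := exists_translate hs ht.continuous hmul hsec p₀.arrow
    have hcont : Continuous (ActionDomain.toProd :
      ActionDomain (hilbertFamily W hW hs.continuous ht hK) → _) := continuous_induced_dom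
    have htube := HilbertFamily.isOpen_tube (hilbertFamily W hW hs.continuous ht hK) isOpen_univ
      (s := s') hs' hε
    filter_upwards [(continuous_fst.comp hcont).continuousAt hss',
      (ht.continuous.comp (continuous_fst.comp hcont)).continuousAt (hV.mem_nhds hp₀.1),
      (continuous_snd.comp hcont).continuousAt (htube.mem_nhds
        ⟨mem_univ _, ((norm_sub_postcomp hss'.self_of_nhds p₀.vec).symm.trans_lt hp₀.2)⟩)] with p h₁ h₂ h₃
    exact ⟨h₂, (norm_sub_postcomp h₁ p.vec).trans_lt h₃.2⟩

end ArrowInto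

/-! ### The faithful unitary representation -/

theorem mainTheorem1 (n m : ℕ) (G₀ : Type u) [CategoryTheory.Groupoid.{v} G₀]
    [TopologicalSpace G₀] [LocallyCompactSpace G₀] [T2Space G₀]
    [ChartedSpace (EuclideanSpace ℝ (Fin n)) G₀]
    [TopologicalSpace (ArrowSpace G₀)] [ChartedSpace (EuclideanSpace ℝ (Fin m)) (ArrowSpace G₀)]
    (hG : IsOrbifoldGroupoid n m G₀) :
    ∃ (E : HilbertFamily.{u, max u v} G₀) (ρ : GroupoidRep E),
      E.IsFiniteDimensional ∧ ρ.IsUnitary ∧ ρ.IsFaithful := by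
  have := hG.secondCountable_obj
  have := hG.t2_arrow
  have : LocallyCompactSpace (ArrowSpace G₀) :=
    ChartedSpace.locallyCompactSpace (EuclideanSpace ℝ (Fin m)) (ArrowSpace G₀)
  have hs := hG.etale_src.isLocalHomeomorph
  have ht := hG.etale_tgt.isLocalHomeomorph
  obtain ⟨W, hW⟩ := exists_isProperTransversal hs.continuous ht.isOpenMap hG.proper
  have := hW.finite_arrowInto hG.proper ht
  refine ⟨_, ArrowInto.translationRep hW.isOpen hs ht hG.continuous_mul
    (hW.exists_isCompact_arrow hG.proper), fun x => ?_, fun {x y} g e e' => ?_, fun x g g' h => ?_⟩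
  · exact inferInstanceAs (FiniteDimensional ℂ (EuclideanSpace ℂ (ArrowInto W x)))
  · exact LinearIsometryEquiv.inner_map_map
      (LinearIsometryEquiv.piLpCongrLeft 2 ℂ ℂ (ArrowInto.postcomp (W := W) g)) e e'
  · classical
    obtain ⟨a, ha, ⟨k⟩⟩ := hW.exists_hom x
    let i : ArrowInto W x := ⟨a, ha, k⟩
    have h₁ : LinearIsometryEquiv.piLpCongrLeft 2 ℂ ℂ (ArrowInto.postcomp g)
        (EuclideanSpace.single i 1) = LinearIsometryEquiv.piLpCongrLeft 2 ℂ ℂ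
          (ArrowInto.postcomp g') (EuclideanSpace.single i 1) :=
      LinearEquiv.congr_fun h (EuclideanSpace.single i (1 : ℂ))
    rw [EuclideanSpace.piLpCongrLeft_single, EuclideanSpace.piLpCongrLeft_single] at h₁
    -- The basis vector at `k` is sent to those at `k ≫ g` and `k ≫ g'`, so equal actions force
    -- these arrows to coincide.
    have h₂ : ArrowInto.postcomp g i = ArrowInto.postcomp g' i := by
      by_contra hne
      have := congrArg (fun v : EuclideanSpace ℂ (ArrowInto W x) => v (ArrowInto.postcomp g i)) h₁
      simp [hne] at this
    exact (cancel_epi k).1 (by injection h₂)
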